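/- Let $A,B,C,D,E,F$ be real matrices of compatible dimensions and consider the linear discrete-time system $$x(t+1)=Ax(t)+Bu(t)+Ew(t),\qquad y(t)=Cx(t)+Du(t)+Fv(t),\qquad t\in\mathbb N=\{0,1,2,\dots\},$$ with states, inputs, process disturbances, output disturbances and outputs in $\mathbb R^{n_x},\mathbb R^{n_u},\mathbb R^{n_w},\mathbb R^{n_v},\mathbb R^{n_y}$ carrying the Euclidean norms. A tuple of sequences $\{x,u,w,v,y\}$ satisfying both equations for all $t$ is called a solution. The system is *detectable* if $x(t)\to0$ as $t\to\infty$ for every solution with $u,w,v,y\equiv 0$. A function $\alpha:[0,\infty)\to[0,\infty)$ is of class $\mathcal K$ if it is continuous, strictly increasing and $\alpha(0)=0$; $\beta:[0,\infty)\times\mathbb N\to[0,\infty)$ is of class $\mathcal{KL}$ if $\beta(\cdot,t)\in\mathcal K$ for each $t$ and $\beta(r,\cdot)$ is non-increasing with limit $0$ for each $r$. The system is *time-discounted incrementally input/output-to-state stable (i-IOSS) in the sum-based form* if there are $\alpha_1\in\mathcal K$ and $\beta,\gamma,\delta,\epsilon,\varphi\in\mathcal{KL}$ such that for any two solutions $\{x,u,w,v,y\}$,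 $\{\chi,\upsilon,\omega,\nu,\zeta\}$ and all $t\in\mathbb N$ $$\alpha_1(\|x(t)-\chi(t)\|)\le\beta(\|x(0)-\chi(0)\|,t)+\sum_{\tau=1}^{t}\Big(\gamma(\|w_\Delta(t-\tau)\|,\tau)+\delta(\|v_\Delta(t-\tau)\|,\tau)+\epsilon(\|u_\Delta(t-\tau)\|,\tau)+\varphi(\|y_\Delta(t-\tau)\|,\tau)\Big),$$ where $x_\Delta=x-\chi$, $w_\Delta=w-\omega$, $v_\Delta=v-\nu$, $u_\Delta=u-\upsilon$, $y_\Delta=y-\zeta$. Then: (i) The system is detectable if and only if it is time-discounted i-IOSS in the sum-based form. (ii) If the system is detectable, there are symmetric positive definite $P,Q\in\mathbb R^{n_x\times n_x}$ and $L\in\mathbb R^{n_x\times n_y}$ with $A_L^\top PA_L=P-Q$, where $A_L:=A+LC$. (iii) For every $L\in\mathbb R^{n_x\times n_y}$, any two solutions and every $t\in\mathbb N$, $$x_\Delta(t)=A_L^t x_\Delta(0)+\sum_{\tau=1}^tA_L^{\tau-1}\big[Ew_\Delta(t-\tau)+LFv_\Delta(t-\tau)+(B+LD)u_\Delta(t-\tau)-Ly_\Delta(t-\tau)\big].$$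 (iv) For all $P,Q,L$ as in (ii), with $g(M):=\|P^{1/2}M\|$ (spectral norm), any two solutions satisfy for all $t\in\mathbb N$ $$\sqrt{\lambda_{\min}(P)}\,\|x_\Delta(t)\|\le g(A_L^t)\|x_\Delta(0)\|+\sum_{\tau=1}^t\Big(g(A_L^{\tau-1}E)\|w_\Delta(t-\tau)\|+g(A_L^{\tau-1}LF)\|v_\Delta(t-\tau)\|+g(A_L^{\tau-1}(B+LD))\|u_\Delta(t-\tau)\|+g(A_L^{\tau-1}L)\|y_\Delta(t-\tau)\|\Big),$$ and for every real matrix $M$ with $n_x$ rows the sequence $t\mapsto g(A_L^tM)$ is non-increasing and tends to $0$. (If $n_x=0$, read $\lambda_{\min}(P)=0$.) -/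

import Mathlib

open scoped NNReal Matrix MatrixOrder Matrix.Norms.L2Operator
open Filter Topology

noncomputable section

/-- Class `𝒦`: continuous, strictly increasing functions `[0, ∞) → [0, ∞)` vanishing at `0`. -/
def IsClassK (α : ℝ≥0 → ℝ≥0) : Prop :=
  Continuous α ∧ StrictMono α ∧ α 0 = 0

/-- Class `ℒ`: non-increasing functions `ℕ → [0, ∞)` tending to `0`. -/
def IsClassL (a : ℕ → ℝ≥0) : Prop :=
  Antitone a ∧ Tendsto a atTop (𝓝 0)

/-- Class `𝒦ℒ`: functions `[0, ∞) × ℕ → [0, ∞)` of class `𝒦` in the first argument and of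
class `ℒ` in the second one. -/
def IsClassKL (β : ℝ≥0 → ℕ → ℝ≥0) : Prop :=
  (∀ t, IsClassK fun r => β r t) ∧ ∀ r, IsClassL (β r)

/-- A discrete-time system `x(t+1) = f(x(t), u(t), w(t))`, `y(t) = h(x(t), u(t), v(t))` with
states in `X`, inputs in `U`, process disturbances in `W`, output disturbances in `V` and outputs
in `Y`. -/
structure DiscreteSystem (X U W V Y : Type*) where
  f : X → U → W → X
  h : X → U → V → Y

namespace DiscreteSystem

variable {X U W V Y : Type*}

/-- `{x, u, w, v, y}` is a solution of the system. -/
def IsSolution (S : DiscreteSystem X U W V Y)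
    (x : ℕ → X) (u : ℕ → U) (w : ℕ → W) (v : ℕ → V) (y : ℕ → Y) : Prop :=
  ∀ t, x (t + 1) = S.f (x t) (u t) (w t) ∧ y t = S.h (x t) (u t) (v t)

/-- Time-discounted incremental input/output-to-state stability in the sum-based form. -/
def IsSumIIOSS [PseudoMetricSpace X] [PseudoMetricSpace U] [PseudoMetricSpace W]
    [PseudoMetricSpace V] [PseudoMetricSpace Y] (S : DiscreteSystem X U W V Y) : Prop :=
  ∃ (α : ℝ≥0 → ℝ≥0) (β γ δ ε φ : ℝ≥0 → ℕ → ℝ≥0),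
    IsClassK α ∧ IsClassKL β ∧ IsClassKL γ ∧ IsClassKL δ ∧ IsClassKL ε ∧ IsClassKL φ ∧
    ∀ (x χ : ℕ → X) (u υ : ℕ → U) (w ω : ℕ → W) (v ν : ℕ → V) (y ζ : ℕ → Y),
      S.IsSolution x u w v y → S.IsSolution χ υ ω ν ζ →
      ∀ t : ℕ, α (nndist (x t) (χ t)) ≤ β (nndist (x 0) (χ 0)) t +
        ∑ τ ∈ Finset.Icc 1 t,
          (γ (nndist (w (t - τ)) (ω (t - τ))) τ + δ (nndist (v (t - τ)) (ν (t - τ))) τ +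
            ε (nndist (u (t - τ)) (υ (t - τ))) τ + φ (nndist (y (t - τ)) (ζ (t - τ))) τ)

end DiscreteSystem

/-- The matrix `M` acting on Euclidean vectors. -/
def Matrix.act {m n : ℕ} (M : Matrix (Fin m) (Fin n) ℝ) (x : EuclideanSpace ℝ (Fin n)) :
    EuclideanSpace ℝ (Fin m) :=
  WithLp.toLp 2 (M *ᵥ x.ofLp)

/-- The matrices of a linear time-invariant system `x⁺ = A x + B u + E w`,
`y = C x + D u + F v`. -/
structure LinearSystem (nx nu nw nv ny : ℕ) where
  A : Matrix (Fin nx) (Fin nx) ℝ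
  B : Matrix (Fin nx) (Fin nu) ℝ
  E : Matrix (Fin nx) (Fin nw) ℝ
  C : Matrix (Fin ny) (Fin nx) ℝ
  D : Matrix (Fin ny) (Fin nu) ℝ
  F : Matrix (Fin ny) (Fin nv) ℝ

namespace LinearSystem

variable {nx nu nw nv ny : ℕ}

/-- The discrete-time system over Euclidean spaces given by the matrices of a linear system. -/
def toSystem (S : LinearSystem nx nu nw nv ny) :
    DiscreteSystem (EuclideanSpace ℝ (Fin nx)) (EuclideanSpace ℝ (Fin nu))
      (EuclideanSpace ℝ (Fin nw)) (EuclideanSpace ℝ (Fin nv)) (EuclideanSpace ℝ (Fin ny)) where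
  f x u w := S.A.act x + S.B.act u + S.E.act w
  h x u v := S.C.act x + S.D.act u + S.F.act v

/-- Detectability: with zero input and zero disturbances, every state trajectory that produces
the zero output tends to zero. -/
def Detectable (S : LinearSystem nx nu nw nv ny) : Prop :=
  ∀ x : ℕ → EuclideanSpace ℝ (Fin nx),
    S.toSystem.IsSolution x 0 0 0 0 → Tendsto x atTop (𝓝 0)

/-- The matrix `A_L = A + L C` of the error dynamics under output injection with gain `L`. -/
def AL (S : LinearSystem nx nu nw nv ny) (L : Matrix (Fin nx) (Fin ny) ℝ) :
    Matrix (Fin nx) (Fin nx) ℝ :=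
  S.A + L * S.C

/-- `P` and `Q` are symmetric positive definite and `A_Lᵀ P A_L = P - Q`. -/
def IsLyapunovTriple (S : LinearSystem nx nu nw nv ny) (P Q : Matrix (Fin nx) (Fin nx) ℝ)
    (L : Matrix (Fin nx) (Fin ny) ℝ) : Prop :=
  P.PosDef ∧ Q.PosDef ∧ (S.AL L)ᵀ * P * S.AL L = P - Q

end LinearSystem

/-- The gain of `M` from the Euclidean norm to the norm `‖z‖_P = ‖P^{1/2} z‖`, i.e. the spectral
norm of `P^{1/2} M`. -/
def gainP {n m : ℕ} (P : Matrix (Fin n) (Fin n) ℝ) (M : Matrix (Fin n) (Fin m) ℝ) : ℝ :=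
  ‖CFC.sqrt P * M‖

/-- The smallest eigenvalue of a symmetric real matrix (and `0` for the empty matrix). -/
def lambdaMin {n : ℕ} (P : Matrix (Fin n) (Fin n) ℝ) : ℝ :=
  sInf (spectrum ℝ P)

end

/-!
The substance is the existence of a Lyapunov triple for a detectable system; everything else follows
from the variation of constants formula for the error `x - χ` under output injection
(`LinearSystem.error_formula`).

**Constructing the triple.** Two steps avoid both Riccati equations and spectral decompositions.

* *Duality.* There is `P > 0` with `(A x)ᵀ P (A x) < xᵀ P x` for all nonzero `x ∈ ker C`
  (`Matrix.exists_posDef_contracting_on_ker`). Consider the compact convex set of positive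
  semidefinite `Z` with trace one and `C Z = 0`. If `A Z Aᵀ ≥ Z` for such a `Z = G Gᵀ`, then a
  dimension count shows that `A` maps the range of `G` onto itself; this range lies in `ker C`, so by
  detectability `A ^ t G → 0`. But iterating the inequality gives `‖A ^ t G‖ ≥ ‖G‖`, whence `G = 0`,
  contradicting the trace (`Matrix.eq_zero_of_posSemidef_of_decay`). Hence the matrices
  `A Z Aᵀ - Z` are disjoint from the closed positive semidefinite cone, and the Hahn–Banach theorem
  gives a functional that is nonnegative on the cone and uniformly negative on them. Its values
  on rank-one matrices `x xᵀ`, plus a small multiple of `‖x‖²`, form the quadratic form of `P`.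

* *Injection.* Let `T` be the `P`-orthogonal projection onto `ker C`. Then `A T - A` vanishes on
  `ker C`, so it equals `L C` for some `L`, and `A + L C = A T` satisfies
  `‖A T x‖_P < ‖T x‖_P ≤ ‖x‖_P` unless `T x = 0` (`Matrix.exists_injection_contracting`). So
  `Q = P - A_Lᵀ P A_L` is positive definite (`LinearSystem.Detectable.exists_isLyapunovTriple`).

**Using the triple.** The `P`-norm decreases along `A_L`, and the decrements `zᵀ Q z` along an orbit
have a finite sum by telescoping, so `A_L ^ t → 0`; this gives the monotonicity and the limit of the
gains. Taking `P`-norms in the variation of constants formula gives the discounted bound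
(`LinearSystem.IsLyapunovTriple.dist_le`), and hence the stability estimate once the gains are
made strictly positive. Conversely, comparing an unobserved trajectory with the zero solution turns
the stability estimate into detectability.
-/

/-! ### Matrices acting on Euclidean vectors -/

namespace Matrix

variable {m n k : ℕ}

theorem act_add (M : Matrix (Fin m) (Fin n) ℝ) (x y : EuclideanSpace ℝ (Fin n)) :
    M.act (x + y) = M.act x + M.act y := by
  simp [act, mulVec_add]

theorem act_sub (M : Matrix (Fin m) (Fin n) ℝ) (x y : EuclideanSpace ℝ (Fin n)) :
    M.act (x - y) = M.act x - M.act y := by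
  simp [act, mulVec_sub]

theorem act_zero (M : Matrix (Fin m) (Fin n) ℝ) : M.act 0 = 0 := by
  simp [act]

theorem act_sum {ι : Type*} (M : Matrix (Fin m) (Fin n) ℝ) (s : Finset ι)
    (x : ι → EuclideanSpace ℝ (Fin n)) : M.act (∑ i ∈ s, x i) = ∑ i ∈ s, M.act (x i) := by
  classical
  induction s using Finset.induction_on with
  | empty => simp [act_zero]
  | insert i s hi ih => rw [Finset.sum_insert hi, Finset.sum_insert hi, act_add, ih]

theorem add_act (M N : Matrix (Fin m) (Fin n) ℝ) (x : EuclideanSpace ℝ (Fin n)) :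
    (M + N).act x = M.act x + N.act x := by
  simp [act, add_mulVec]

theorem sub_act (M N : Matrix (Fin m) (Fin n) ℝ) (x : EuclideanSpace ℝ (Fin n)) :
    (M - N).act x = M.act x - N.act x := by
  simp [act, sub_mulVec]

theorem zero_act (x : EuclideanSpace ℝ (Fin n)) :
    (0 : Matrix (Fin m) (Fin n) ℝ).act x = 0 := by
  simp [act]

theorem one_act (x : EuclideanSpace ℝ (Fin n)) : (1 : Matrix (Fin n) (Fin n) ℝ).act x = x := by
  simp [act]

theorem mul_act (M : Matrix (Fin m) (Fin n) ℝ) (N : Matrix (Fin n) (Fin k) ℝ)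
    (x : EuclideanSpace ℝ (Fin k)) : (M * N).act x = M.act (N.act x) := by
  simp [act, mulVec_mulVec]

theorem norm_act_le (M : Matrix (Fin m) (Fin n) ℝ) (x : EuclideanSpace ℝ (Fin n)) :
    ‖M.act x‖ ≤ ‖M‖ * ‖x‖ := l2_opNorm_mulVec M x

theorem norm_le_of_norm_act_le {M : Matrix (Fin m) (Fin n) ℝ} {c : ℝ} (hc : 0 ≤ c)
    (h : ∀ x, ‖M.act x‖ ≤ c * ‖x‖) : ‖M‖ ≤ c := by
  rw [l2_opNorm_def]
  exact ContinuousLinearMap.opNorm_le_bound _ hc h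

theorem norm_sq_eq_dotProduct (x : EuclideanSpace ℝ (Fin n)) : ‖x‖ ^ 2 = x.ofLp ⬝ᵥ x.ofLp := by
  rw [EuclideanSpace.real_norm_sq_eq]
  simp [dotProduct, sq]

theorem norm_act_sq (M : Matrix (Fin m) (Fin n) ℝ) (x : EuclideanSpace ℝ (Fin n)) :
    ‖M.act x‖ ^ 2 = x.ofLp ⬝ᵥ (Mᵀ * M) *ᵥ x.ofLp := by
  rw [norm_sq_eq_dotProduct, ← mulVec_mulVec, dotProduct_mulVec, vecMul_transpose]
  rfl

/-- Pointwise convergence to `0` of a sequence of matrices is convergence in norm. -/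
theorem tendsto_zero_of_act {M : ℕ → Matrix (Fin m) (Fin n) ℝ}
    (h : ∀ x, Tendsto (fun t => (M t).act x) atTop (𝓝 0)) : Tendsto M atTop (𝓝 0) := by
  refine tendsto_pi_nhds.2 fun i => tendsto_pi_nhds.2 fun j => ?_
  have h1 := h (EuclideanSpace.single j 1)
  have h2 := (((EuclideanSpace.proj i : EuclideanSpace ℝ (Fin m) →L[ℝ] ℝ).continuous.tendsto 0).comp
    h1)
  simpa [act, Function.comp_def] using h2

theorem transpose_sqrt (P : Matrix (Fin n) (Fin n) ℝ) : (CFC.sqrt P)ᵀ = CFC.sqrt P := by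
  have h := (CFC.sqrt_nonneg P).isSelfAdjoint.star_eq
  rwa [star_eq_conjTranspose, conjTranspose_eq_transpose_of_trivial] at h

theorem PosSemidef.sqrt_mul_sqrt {P : Matrix (Fin n) (Fin n) ℝ} (hP : P.PosSemidef) :
    CFC.sqrt P * CFC.sqrt P = P :=
  CFC.sqrt_mul_sqrt_self P hP.nonneg

/-- The square root of `P` turns the quadratic form of `P` into a Euclidean norm. -/
theorem PosSemidef.norm_sqrt_act_sq {P : Matrix (Fin n) (Fin n) ℝ} (hP : P.PosSemidef)
    (x : EuclideanSpace ℝ (Fin n)) : ‖(CFC.sqrt P).act x‖ ^ 2 = x.ofLp ⬝ᵥ P *ᵥ x.ofLp := by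
  rw [norm_act_sq, transpose_sqrt, hP.sqrt_mul_sqrt]

end Matrix

open Matrix

/-! ### The smallest eigenvalue of a positive definite matrix -/

theorem lambdaMin_pos {n : ℕ} (hn : n ≠ 0) {P : Matrix (Fin n) (Fin n) ℝ} (hP : P.PosDef) :
    0 < lambdaMin P := by
  have : Nonempty (Fin n) := ⟨⟨0, Nat.pos_of_ne_zero hn⟩⟩
  have h : lambdaMin P ∈ Set.range hP.isHermitian.eigenvalues := by
    rw [lambdaMin, hP.isHermitian.spectrum_real_eq_range_eigenvalues]
    exact (Set.range_nonempty _).csInf_mem (Set.finite_range _)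
  obtain ⟨i, hi⟩ := h
  rw [← hi]
  exact hP.eigenvalues_pos i

theorem lambdaMin_nonneg {n : ℕ} {P : Matrix (Fin n) (Fin n) ℝ} (hP : P.PosDef) :
    0 ≤ lambdaMin P := by
  rw [lambdaMin, hP.isHermitian.spectrum_real_eq_range_eigenvalues]
  refine Real.sInf_nonneg ?_
  rintro _ ⟨i, rfl⟩
  exact (hP.eigenvalues_pos i).le

/-- The lower Rayleigh bound `λ_min(P) ‖x‖² ≤ xᵀ P x`. -/
theorem lambdaMin_mul_norm_sq_le {n : ℕ} {P : Matrix (Fin n) (Fin n) ℝ} (hP : P.IsHermitian)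
    (x : EuclideanSpace ℝ (Fin n)) : lambdaMin P * ‖x‖ ^ 2 ≤ x.ofLp ⬝ᵥ P *ᵥ x.ofLp := by
  have hpsd : (P - algebraMap ℝ _ (lambdaMin P)).PosSemidef := by
    rw [← Matrix.nonneg_iff_posSemidef, sub_nonneg]
    refine (algebraMap_le_iff_le_spectrum (a := P) (ha := hP)).2 fun r hr => ?_
    refine csInf_le ?_ hr
    rw [hP.spectrum_real_eq_range_eigenvalues]
    exact (Set.finite_range _).bddBelow
  have h := hpsd.dotProduct_mulVec_nonneg x.ofLp
  rw [sub_mulVec, dotProduct_sub, Algebra.algebraMap_eq_smul_one, smul_mulVec, one_mulVec,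
    dotProduct_smul, star_trivial, smul_eq_mul, ← norm_sq_eq_dotProduct] at h
  linarith

theorem sqrt_lambdaMin_mul_norm_le {n : ℕ} {P : Matrix (Fin n) (Fin n) ℝ} (hP : P.PosDef)
    (x : EuclideanSpace ℝ (Fin n)) : √(lambdaMin P) * ‖x‖ ≤ ‖(CFC.sqrt P).act x‖ := by
  refine le_of_sq_le_sq ?_ (norm_nonneg _)
  rw [mul_pow, Real.sq_sqrt (lambdaMin_nonneg hP), hP.posSemidef.norm_sqrt_act_sq]
  exact lambdaMin_mul_norm_sq_le hP.isHermitian x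

theorem Matrix.PosDef.tendsto_zero {n : ℕ} {Q : Matrix (Fin n) (Fin n) ℝ} (hQ : Q.PosDef)
    {z : ℕ → EuclideanSpace ℝ (Fin n)}
    (hz : Tendsto (fun t => (z t).ofLp ⬝ᵥ Q *ᵥ (z t).ofLp) atTop (𝓝 0)) :
    Tendsto z atTop (𝓝 0) := by
  rcases Nat.eq_zero_or_pos n with rfl | hn
  · exact tendsto_const_nhds.congr fun t => Subsingleton.elim _ _
  have hl := lambdaMin_pos hn.ne' hQ
  have h1 : Tendsto (fun t => ‖z t‖ ^ 2) atTop (𝓝 0) := by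
    refine squeeze_zero (fun t => by positivity) (fun t => ?_)
      (by simpa using hz.const_mul (lambdaMin Q)⁻¹)
    rw [le_inv_mul_iff₀ hl]
    exact lambdaMin_mul_norm_sq_le hQ.isHermitian _
  have h2 : Tendsto (fun t => √(‖z t‖ ^ 2)) atTop (𝓝 0) := by
    simpa using h1.sqrt
  exact tendsto_zero_iff_norm_tendsto_zero.2 (by simpa using h2)

theorem norm_sqrt_act_mul_le {m n : ℕ} (P : Matrix (Fin n) (Fin n) ℝ)
    (M : Matrix (Fin n) (Fin m) ℝ) (x : EuclideanSpace ℝ (Fin m)) :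
    ‖(CFC.sqrt P).act (M.act x)‖ ≤ gainP P M * ‖x‖ := by
  rw [← mul_act]
  exact norm_act_le _ x

/-! ### Error dynamics under output injection -/

namespace LinearSystem

variable {nx nu nw nv ny : ℕ} {S : LinearSystem nx nu nw nv ny}
  {P Q : Matrix (Fin nx) (Fin nx) ℝ} {L : Matrix (Fin nx) (Fin ny) ℝ}

/-- Along the closed loop, `z ↦ zᵀ P z` decreases by `zᵀ Q z`. -/
theorem IsLyapunovTriple.norm_sqrt_act_sq (h : S.IsLyapunovTriple P Q L)
    (z : EuclideanSpace ℝ (Fin nx)) :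
    ‖(CFC.sqrt P).act ((S.AL L).act z)‖ ^ 2 =
      ‖(CFC.sqrt P).act z‖ ^ 2 - z.ofLp ⬝ᵥ Q *ᵥ z.ofLp := by
  rw [← mul_act, norm_act_sq, h.1.posSemidef.norm_sqrt_act_sq, ← dotProduct_sub, ← sub_mulVec,
    ← h.2.2, transpose_mul, transpose_sqrt]
  congr 2
  rw [Matrix.mul_assoc, ← Matrix.mul_assoc (CFC.sqrt P), h.1.posSemidef.sqrt_mul_sqrt,
    Matrix.mul_assoc]

theorem IsLyapunovTriple.norm_sqrt_act_le (h : S.IsLyapunovTriple P Q L)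
    (z : EuclideanSpace ℝ (Fin nx)) :
    ‖(CFC.sqrt P).act ((S.AL L).act z)‖ ≤ ‖(CFC.sqrt P).act z‖ := by
  refine le_of_sq_le_sq ?_ (norm_nonneg _)
  have h1 := h.2.1.posSemidef.dotProduct_mulVec_nonneg z.ofLp
  rw [star_trivial] at h1
  rw [h.norm_sqrt_act_sq]
  linarith

/-- The decrements `zᵀ Q z` along the orbit of `A_L` are summable by telescoping, so the orbit tends
to `0`. -/
theorem IsLyapunovTriple.tendsto_pow_act (h : S.IsLyapunovTriple P Q L)
    (z : EuclideanSpace ℝ (Fin nx)) :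
    Tendsto (fun t : ℕ => (S.AL L ^ t).act z) atTop (𝓝 0) := by
  refine h.2.1.tendsto_zero ?_
  refine (summable_of_sum_range_le (c := ‖(CFC.sqrt P).act z‖ ^ 2) (fun t => ?_)
    fun t => ?_).tendsto_atTop_zero
  · simpa using h.2.1.posSemidef.dotProduct_mulVec_nonneg ((S.AL L ^ t).act z).ofLp
  · have hsum : ∑ i ∈ Finset.range t,
        ((S.AL L ^ i).act z).ofLp ⬝ᵥ Q *ᵥ ((S.AL L ^ i).act z).ofLp =
        ‖(CFC.sqrt P).act z‖ ^ 2 - ‖(CFC.sqrt P).act ((S.AL L ^ t).act z)‖ ^ 2 := by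
      induction t with
      | zero => simp [one_act]
      | succ t ih =>
        rw [Finset.sum_range_succ, ih, pow_succ' _ t, mul_act, h.norm_sqrt_act_sq]
        ring
    rw [hsum]
    linarith [sq_nonneg ‖(CFC.sqrt P).act ((S.AL L ^ t).act z)‖]

theorem IsLyapunovTriple.antitone_gainP (h : S.IsLyapunovTriple P Q L) {m : ℕ}
    (M : Matrix (Fin nx) (Fin m) ℝ) : Antitone fun t : ℕ => gainP P (S.AL L ^ t * M) := by
  refine antitone_nat_of_succ_le fun t => ?_
  refine norm_le_of_norm_act_le (norm_nonneg _) fun x => ?_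
  rw [pow_succ', Matrix.mul_assoc, mul_act, mul_act]
  exact (h.norm_sqrt_act_le _).trans (norm_sqrt_act_mul_le _ _ _)

theorem IsLyapunovTriple.tendsto_gainP (h : S.IsLyapunovTriple P Q L) {m : ℕ}
    (M : Matrix (Fin nx) (Fin m) ℝ) :
    Tendsto (fun t : ℕ => gainP P (S.AL L ^ t * M)) atTop (𝓝 0) := by
  have h1 : Tendsto (fun t : ℕ => S.AL L ^ t) atTop (𝓝 0) :=
    tendsto_zero_of_act h.tendsto_pow_act
  have h2 : Continuous fun N : Matrix (Fin nx) (Fin nx) ℝ => gainP P (N * M) := by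
    unfold gainP
    fun_prop
  simpa [gainP, Function.comp_def] using (h2.tendsto 0).comp h1

/-- One step of the error dynamics: output injection adds `L (C x + D u + F v - y) = 0`. -/
theorem error_step (S : LinearSystem nx nu nw nv ny) (L : Matrix (Fin nx) (Fin ny) ℝ)
    {x χ : ℕ → EuclideanSpace ℝ (Fin nx)} {u υ : ℕ → EuclideanSpace ℝ (Fin nu)}
    {w ω : ℕ → EuclideanSpace ℝ (Fin nw)} {v ν : ℕ → EuclideanSpace ℝ (Fin nv)}
    {y ζ : ℕ → EuclideanSpace ℝ (Fin ny)}
    (h : S.toSystem.IsSolution x u w v y) (h' : S.toSystem.IsSolution χ υ ω ν ζ) (t : ℕ) :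
    x (t + 1) - χ (t + 1) = (S.AL L).act (x t - χ t) +
      (S.E.act (w t - ω t) + (L * S.F).act (v t - ν t) +
        (S.B + L * S.D).act (u t - υ t) - L.act (y t - ζ t)) := by
  obtain ⟨hx, hy⟩ := h t
  obtain ⟨hχ, hζ⟩ := h' t
  rw [hx, hχ, hy, hζ]
  simp only [toSystem, AL, add_act, mul_act, act_add, act_sub]
  abel

/-- Variation of constants for the error dynamics under output injection. -/
theorem error_formula (S : LinearSystem nx nu nw nv ny) (L : Matrix (Fin nx) (Fin ny) ℝ)
    {x χ : ℕ → EuclideanSpace ℝ (Fin nx)} {u υ : ℕ → EuclideanSpace ℝ (Fin nu)}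
    {w ω : ℕ → EuclideanSpace ℝ (Fin nw)} {v ν : ℕ → EuclideanSpace ℝ (Fin nv)}
    {y ζ : ℕ → EuclideanSpace ℝ (Fin ny)}
    (h : S.toSystem.IsSolution x u w v y) (h' : S.toSystem.IsSolution χ υ ω ν ζ) (t : ℕ) :
    x t - χ t = (S.AL L ^ t).act (x 0 - χ 0) +
      ∑ τ ∈ Finset.Icc 1 t, (S.AL L ^ (τ - 1)).act
        (S.E.act (w (t - τ) - ω (t - τ)) + (L * S.F).act (v (t - τ) - ν (t - τ)) +
          (S.B + L * S.D).act (u (t - τ) - υ (t - τ)) - L.act (y (t - τ) - ζ (t - τ))) := by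
  induction t with
  | zero => simp [one_act]
  | succ t ih =>
    rw [S.error_step L h h' t, ih, act_add, act_sum, pow_succ', mul_act (S.AL L), add_assoc]
    congr 1
    -- The summand `τ = 1` is the newest disturbance; the others are the old ones, shifted by one.
    have hsum : ∀ (k : ℕ) (f : ℕ → EuclideanSpace ℝ (Fin nx)),
        ∑ τ ∈ Finset.Icc 1 k, f τ = ∑ i ∈ Finset.range k, f (i + 1) := fun k f => by
      rw [Finset.range_eq_Ico, Finset.sum_Ico_add' f 0 k 1, zero_add]
      rfl
    rw [hsum, hsum, Finset.sum_range_succ']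
    simp only [Nat.add_sub_add_right, add_tsub_cancel_right, zero_add, pow_zero,
      one_act, tsub_self]
    congr 1
    refine Finset.sum_congr rfl fun i _ => ?_
    rw [pow_succ', mul_act (S.AL L)]

/-- The discounted error bound obtained by measuring `error_formula` in the norm of `P`. -/
theorem IsLyapunovTriple.dist_le (hP : S.IsLyapunovTriple P Q L)
    {x χ : ℕ → EuclideanSpace ℝ (Fin nx)} {u υ : ℕ → EuclideanSpace ℝ (Fin nu)}
    {w ω : ℕ → EuclideanSpace ℝ (Fin nw)} {v ν : ℕ → EuclideanSpace ℝ (Fin nv)}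
    {y ζ : ℕ → EuclideanSpace ℝ (Fin ny)}
    (h : S.toSystem.IsSolution x u w v y) (h' : S.toSystem.IsSolution χ υ ω ν ζ) (t : ℕ) :
    √(lambdaMin P) * dist (x t) (χ t) ≤
      gainP P (S.AL L ^ t) * dist (x 0) (χ 0) +
      ∑ τ ∈ Finset.Icc 1 t,
        (gainP P (S.AL L ^ (τ - 1) * S.E) * dist (w (t - τ)) (ω (t - τ)) +
          gainP P (S.AL L ^ (τ - 1) * (L * S.F)) * dist (v (t - τ)) (ν (t - τ)) +
          gainP P (S.AL L ^ (τ - 1) * (S.B + L * S.D)) * dist (u (t - τ)) (υ (t - τ)) +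
          gainP P (S.AL L ^ (τ - 1) * L) * dist (y (t - τ)) (ζ (t - τ))) := by
  simp only [dist_eq_norm]
  refine (sqrt_lambdaMin_mul_norm_le hP.1 _).trans ?_
  rw [S.error_formula L h h' t, act_add, act_sum]
  refine (norm_add_le _ _).trans (add_le_add (norm_sqrt_act_mul_le _ _ _) ?_)
  refine (norm_sum_le _ _).trans (Finset.sum_le_sum fun τ _ => ?_)
  simp only [act_add, act_sub _ (_ + _), ← mul_act (S.AL L ^ (τ - 1))]
  refine (norm_sub_le _ _).trans (add_le_add ?_ (norm_sqrt_act_mul_le _ _ _))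
  refine (norm_add_le _ _).trans (add_le_add ?_ (norm_sqrt_act_mul_le _ _ _))
  exact (norm_add_le _ _).trans
    (add_le_add (norm_sqrt_act_mul_le _ _ _) (norm_sqrt_act_mul_le _ _ _))

end LinearSystem

/-! ### The covariance obstruction to detectability -/

namespace Matrix

variable {l m n : ℕ}

/-- A matrix whose kernel contains that of `Y` factors through `Y`. -/
theorem exists_eq_mul_of_ker_le {X : Matrix (Fin m) (Fin n) ℝ} {Y : Matrix (Fin l) (Fin n) ℝ}
    (h : ∀ x, Y *ᵥ x = 0 → X *ᵥ x = 0) : ∃ M : Matrix (Fin m) (Fin l) ℝ, X = M * Y := by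
  have hker : LinearMap.ker Y.mulVecLin ≤ LinearMap.ker X.mulVecLin := h
  obtain ⟨g, hg⟩ := LinearMap.exists_extend
    (((LinearMap.ker Y.mulVecLin).liftQ X.mulVecLin hker) ∘ₗ
      Y.mulVecLin.quotKerEquivRange.symm.toLinearMap)
  refine ⟨LinearMap.toMatrix' g, ?_⟩
  apply Matrix.mulVec_injective
  funext x
  have h1 := LinearMap.congr_fun hg ⟨Y *ᵥ x, x, rfl⟩
  have h2 : Y.mulVecLin.quotKerEquivRange.symm ⟨Y *ᵥ x, x, rfl⟩ = Submodule.Quotient.mk x :=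
    Y.mulVecLin.quotKerEquivRange_symm_apply_image x _
  simp only [LinearMap.comp_apply, LinearEquiv.coe_coe, Submodule.subtype_apply, h2] at h1
  rw [← mulVec_mulVec, LinearMap.toMatrix'_mulVec, h1]
  rfl

/-- If `ker (A G)ᵀ ⊆ ker Gᵀ`, i.e. the range of `G` lies in its image under `A`, then by dimension
`A` maps the range of `G` onto itself. -/
theorem exists_mul_eq_mul_of_ker_le {A : Matrix (Fin n) (Fin n) ℝ}
    {G : Matrix (Fin n) (Fin m) ℝ}
    (h : ∀ x, (Gᵀ * Aᵀ) *ᵥ x = 0 → Gᵀ *ᵥ x = 0) :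
    ∃ M : Matrix (Fin m) (Fin m) ℝ, A * G = G * M := by
  have hle : LinearMap.ker (Gᵀ * Aᵀ).mulVecLin ≤ LinearMap.ker Gᵀ.mulVecLin := h
  have heq : LinearMap.ker (Gᵀ * Aᵀ).mulVecLin = LinearMap.ker Gᵀ.mulVecLin := by
    refine Submodule.eq_of_le_of_finrank_le hle ?_
    have h1 := (Gᵀ * Aᵀ).mulVecLin.finrank_range_add_finrank_ker
    have h2 := Gᵀ.mulVecLin.finrank_range_add_finrank_ker
    have h3 : (Gᵀ * Aᵀ).rank ≤ Gᵀ.rank := rank_mul_le_left _ _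
    unfold rank at h3
    omega
  obtain ⟨M, hM⟩ := exists_eq_mul_of_ker_le (X := Gᵀ * Aᵀ) (Y := Gᵀ) heq.ge
  refine ⟨Mᵀ, ?_⟩
  rw [← transpose_inj]
  simpa [transpose_mul] using hM

/-- The covariance-type obstruction to detectability: nonzero `G` with range in `ker C` cannot
satisfy `A G Gᵀ Aᵀ ≥ G Gᵀ` if all unobserved trajectories decay. -/
theorem eq_zero_of_posSemidef_of_decay {A : Matrix (Fin n) (Fin n) ℝ}
    {C : Matrix (Fin l) (Fin n) ℝ} {G : Matrix (Fin n) (Fin m) ℝ}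
    (hdet : ∀ x, (∀ t : ℕ, C.act ((A ^ t).act x) = 0) →
      Tendsto (fun t : ℕ => (A ^ t).act x) atTop (𝓝 0))
    (hG : (A * G * Gᵀ * Aᵀ - G * Gᵀ).PosSemidef) (hC : C * G = 0) : G = 0 := by
  have hle : ∀ x : EuclideanSpace ℝ (Fin n), ‖Gᵀ.act x‖ ≤ ‖Gᵀ.act (Aᵀ.act x)‖ := fun x => by
    refine le_of_sq_le_sq ?_ (norm_nonneg _)
    have h := hG.dotProduct_mulVec_nonneg x.ofLp
    rw [star_trivial, sub_mulVec, dotProduct_sub] at h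
    rw [← mul_act, norm_act_sq, norm_act_sq]
    simp only [transpose_mul, transpose_transpose]
    rw [← Matrix.mul_assoc]
    linarith
  obtain ⟨M, hM⟩ := exists_mul_eq_mul_of_ker_le (A := A) (G := G) fun x hx => by
    have h1 := hle (WithLp.toLp 2 x)
    rw [← mul_act] at h1
    simpa [act, hx] using h1
  have hpow : ∀ t : ℕ, A ^ t * G = G * M ^ t := fun t => by
    induction t with
    | zero => simp
    | succ t ih => rw [pow_succ', Matrix.mul_assoc, ih, ← Matrix.mul_assoc, hM, Matrix.mul_assoc,
        ← pow_succ']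
  have hlim : Tendsto (fun t : ℕ => A ^ t * G) atTop (𝓝 0) := by
    refine tendsto_zero_of_act fun x => ?_
    simp only [mul_act]
    refine hdet _ fun t => ?_
    rw [← mul_act, ← mul_act, Matrix.mul_assoc, hpow, ← Matrix.mul_assoc, hC, Matrix.zero_mul,
      zero_act]
  have hmono : ∀ (t : ℕ) (x : EuclideanSpace ℝ (Fin n)), ‖Gᵀ.act x‖ ≤ ‖(A ^ t * G)ᵀ.act x‖ := by
    intro t
    induction t with
    | zero => simp
    | succ t ih =>
      intro x
      refine (hle x).trans ((ih _).trans_eq ?_)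
      rw [← mul_act, ← transpose_mul, pow_succ', Matrix.mul_assoc]
  have hle' : ∀ t : ℕ, ‖G‖ ≤ ‖A ^ t * G‖ := fun t => by
    rw [← l2_opNorm_conjTranspose G, ← l2_opNorm_conjTranspose (A ^ t * G)]
    refine norm_le_of_norm_act_le (norm_nonneg _) fun x => ?_
    exact (hmono t x).trans (norm_act_le _ x)
  have h0 : ‖G‖ ≤ 0 := by
    have h1 := hlim.norm
    rw [norm_zero] at h1
    exact ge_of_tendsto' h1 hle'
  exact norm_le_zero_iff.1 h0

/-! ### Duality: an inner product in which `A` contracts `ker C` -/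

/-- The positive semidefinite matrices of trace one whose range lies in `ker C`, written as Gram
matrices. -/
def kernelDensities (C : Matrix (Fin l) (Fin n) ℝ) : Set (Matrix (Fin n) (Fin n) ℝ) :=
  (fun G => G * Gᵀ) '' {G : Matrix (Fin n) (Fin n) ℝ | (G * Gᵀ).trace = 1 ∧ C * G = 0}

theorem isCompact_kernelDensities (C : Matrix (Fin l) (Fin n) ℝ) :
    IsCompact (kernelDensities C) := by
  refine IsCompact.image ?_ (by fun_prop)
  have hbox : IsCompact (Set.pi Set.univ fun _ : Fin n => Set.pi Set.univ fun _ : Fin n =>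
      Set.Icc (-1 : ℝ) 1) :=
    isCompact_univ_pi fun _ => isCompact_univ_pi fun _ => isCompact_Icc
  refine hbox.of_isClosed_subset ?_ ?_
  · refine (isClosed_eq ?_ continuous_const).inter (isClosed_eq ?_ continuous_const)
    · fun_prop
    · fun_prop
  · rintro (G : Matrix (Fin n) (Fin n) ℝ) ⟨hG, -⟩ i - j -
    have h1 : ∑ i, ∑ j, G i j ^ 2 = 1 := by
      rw [← hG]
      simp [trace, mul_apply, sq]
    have h2 : G i j ^ 2 ≤ 1 := by
      rw [← h1]
      refine (Finset.single_le_sum (f := fun j => G i j ^ 2) (fun _ _ => sq_nonneg _)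
        (Finset.mem_univ j)).trans ?_
      exact Finset.single_le_sum (f := fun i => ∑ j, G i j ^ 2)
        (fun _ _ => Finset.sum_nonneg fun _ _ => sq_nonneg _) (Finset.mem_univ i)
    exact abs_le.1 ((sq_le_one_iff_abs_le_one _).1 h2)

theorem mem_kernelDensities_iff {C : Matrix (Fin l) (Fin n) ℝ} {Z : Matrix (Fin n) (Fin n) ℝ} :
    Z ∈ kernelDensities C ↔ Z.PosSemidef ∧ Z.trace = 1 ∧ C * Z = 0 := by
  constructor
  · rintro ⟨G, ⟨hG, hC⟩, rfl⟩
    refine ⟨by simpa using posSemidef_self_mul_conjTranspose G, hG, ?_⟩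
    simp only
    rw [← Matrix.mul_assoc, hC, Matrix.zero_mul]
  · rintro ⟨hZ, htr, hC⟩
    refine ⟨CFC.sqrt Z, ⟨?_, ?_⟩, ?_⟩
    · rw [transpose_sqrt, hZ.sqrt_mul_sqrt, htr]
    · rw [← Matrix.self_mul_conjTranspose_eq_zero]
      rw [conjTranspose_eq_transpose_of_trivial, transpose_mul, transpose_sqrt, Matrix.mul_assoc,
        ← Matrix.mul_assoc (CFC.sqrt Z), hZ.sqrt_mul_sqrt, ← Matrix.mul_assoc, hC, Matrix.zero_mul]
    · simp only
      rw [transpose_sqrt, hZ.sqrt_mul_sqrt]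

theorem convex_kernelDensities (C : Matrix (Fin l) (Fin n) ℝ) : Convex ℝ (kernelDensities C) := by
  intro Z hZ W hW a b ha hb hab
  rw [mem_kernelDensities_iff] at *
  refine ⟨(hZ.1.smul ha).add (hW.1.smul hb), ?_, ?_⟩
  · simp [hZ.2.1, hW.2.1, hab]
  · simp [Matrix.mul_add, hZ.2.2, hW.2.2]

/-- Rank-one density of a unit vector in `ker C`. -/
theorem vecMulVec_mem_kernelDensities {C : Matrix (Fin l) (Fin n) ℝ} {x : Fin n → ℝ}
    (hx : x ⬝ᵥ x = 1) (hC : C *ᵥ x = 0) : vecMulVec x x ∈ kernelDensities C := by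
  rw [mem_kernelDensities_iff]
  refine ⟨by simpa using posSemidef_vecMulVec_self_star x, ?_, ?_⟩
  · rw [trace_vecMulVec, hx]
  · rw [mul_vecMulVec, hC, zero_vecMulVec]

theorem isClosed_setOf_posSemidef :
    IsClosed {Z : Matrix (Fin n) (Fin n) ℝ | Z.PosSemidef} := by
  have h : {Z : Matrix (Fin n) (Fin n) ℝ | Z.PosSemidef} =
      {Z | Zᵀ = Z} ∩ ⋂ x : Fin n → ℝ, {Z | 0 ≤ x ⬝ᵥ Z *ᵥ x} := by
    ext Z
    simp [posSemidef_iff_dotProduct_mulVec, IsHermitian, conjTranspose_eq_transpose_of_trivial]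
  rw [h]
  refine (isClosed_eq (by fun_prop) continuous_id).inter (isClosed_iInter fun x => ?_)
  exact isClosed_le continuous_const (by fun_prop)

theorem convex_setOf_posSemidef : Convex ℝ {Z : Matrix (Fin n) (Fin n) ℝ | Z.PosSemidef} :=
  fun _ hZ _ hW _ _ ha hb _ => (hZ.smul ha).add (hW.smul hb)

/-- Every linear functional on matrices is represented on symmetric rank-one matrices by a
symmetric quadratic form. -/
theorem exists_symmetric_representation (f : Matrix (Fin n) (Fin n) ℝ →ₗ[ℝ] ℝ) :
    ∃ P : Matrix (Fin n) (Fin n) ℝ, Pᵀ = P ∧ ∀ x, x ⬝ᵥ P *ᵥ x = f (vecMulVec x x) := by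
  let P₀ : Matrix (Fin n) (Fin n) ℝ := of fun i j => f (single i j 1)
  have h0 : ∀ x, x ⬝ᵥ P₀ *ᵥ x = f (vecMulVec x x) := fun x => by
    have h1 : vecMulVec x x = ∑ i, ∑ j, (x i * x j) • single i j (1 : ℝ) := by
      conv_lhs => rw [matrix_eq_sum_single (vecMulVec x x)]
      simp [vecMulVec_apply, smul_single]
    rw [h1]
    simp only [map_sum, map_smul, smul_eq_mul, dotProduct, mulVec, P₀, of_apply, Finset.mul_sum]
    refine Finset.sum_congr rfl fun i _ => Finset.sum_congr rfl fun j _ => ?_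
    ring
  refine ⟨(1 / 2 : ℝ) • (P₀ + P₀ᵀ), ?_, fun x => ?_⟩
  · simp [add_comm]
  · have h2 : x ⬝ᵥ P₀ᵀ *ᵥ x = x ⬝ᵥ P₀ *ᵥ x := by
      rw [mulVec_transpose, dotProduct_comm, dotProduct_mulVec]
    rw [smul_mulVec, dotProduct_smul, add_mulVec, dotProduct_add, h2, h0, smul_eq_mul]
    ring

/-- Duality step: if unobserved trajectories decay, some inner product makes `A` strictly
contracting on `ker C`. The functional separating the compact convex set of all `A Z Aᵀ - Z` (`Z` a density
on `ker C`) from the semidefinite cone represents this inner product. -/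
theorem exists_posDef_contracting_on_ker {A : Matrix (Fin n) (Fin n) ℝ}
    {C : Matrix (Fin l) (Fin n) ℝ}
    (hdet : ∀ x, (∀ t : ℕ, C.act ((A ^ t).act x) = 0) →
      Tendsto (fun t : ℕ => (A ^ t).act x) atTop (𝓝 0)) :
    ∃ P : Matrix (Fin n) (Fin n) ℝ, P.PosDef ∧ ∀ x, x ≠ 0 → C *ᵥ x = 0 →
      (A *ᵥ x) ⬝ᵥ P *ᵥ (A *ᵥ x) < x ⬝ᵥ P *ᵥ x := by
  let Φ : Matrix (Fin n) (Fin n) ℝ →ₗ[ℝ] Matrix (Fin n) (Fin n) ℝ :=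
    { toFun := fun Z => A * Z * Aᵀ - Z
      map_add' := fun Z W => by rw [Matrix.mul_add, Matrix.add_mul]; abel
      map_smul' := fun c Z => by simp [smul_sub] }
  have hΦc : Continuous Φ := Φ.continuous_of_finiteDimensional
  have hdisj : Disjoint (Φ '' kernelDensities C)
      {Z : Matrix (Fin n) (Fin n) ℝ | Z.PosSemidef} := by
    rw [Set.disjoint_left]
    rintro _ ⟨_, ⟨G, ⟨htr, hC⟩, rfl⟩, rfl⟩ hpsd
    have hG : G = 0 := eq_zero_of_posSemidef_of_decay hdet
      (by simpa [Φ, Matrix.mul_assoc] using hpsd) hC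
    simp [hG] at htr
  obtain ⟨f, u, v, hfu, huv, hfv⟩ := geometric_hahn_banach_compact_closed
    ((convex_kernelDensities C).linear_image Φ) ((isCompact_kernelDensities C).image hΦc)
    convex_setOf_posSemidef isClosed_setOf_posSemidef hdisj
  have hv0 : v < 0 := by simpa using hfv 0 PosSemidef.zero
  -- A functional bounded below on a cone is nonnegative there.
  have hnonneg : ∀ Z : Matrix (Fin n) (Fin n) ℝ, Z.PosSemidef → 0 ≤ f Z := by
    intro Z hZ
    by_contra! hneg
    have h1 := hfv ((v / f Z) • Z) (hZ.smul (div_nonneg_of_nonpos hv0.le hneg.le))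
    rw [map_smul, smul_eq_mul, div_mul_cancel₀ _ hneg.ne] at h1
    exact lt_irrefl _ h1
  obtain ⟨P₀, hsymm, hP₀⟩ := exists_symmetric_representation f.toLinearMap
  -- The margin `-u > 0` leaves room for adding a small multiple of the identity.
  obtain ⟨ε, hε, hεA⟩ : ∃ ε : ℝ, 0 < ε ∧ ε * ‖A‖ ^ 2 < -u := by
    refine ⟨-u / (‖A‖ ^ 2 + 1), div_pos (by linarith) (by positivity), ?_⟩
    rw [div_mul_eq_mul_div, div_lt_iff₀ (by positivity)]
    nlinarith
  have hquad : ∀ x : Fin n → ℝ,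
      x ⬝ᵥ (P₀ + ε • 1) *ᵥ x = f (vecMulVec x x) + ε * (x ⬝ᵥ x) := fun x => by
    rw [add_mulVec, dotProduct_add, hP₀, smul_mulVec, one_mulVec, dotProduct_smul, smul_eq_mul]
    rfl
  have hpsd : ∀ x : Fin n → ℝ, (vecMulVec x x).PosSemidef := fun x => by
    simpa using posSemidef_vecMulVec_self_star x
  have hunit : ∀ x : EuclideanSpace ℝ (Fin n), ‖x‖ = 1 → C *ᵥ x.ofLp = 0 →
      (A *ᵥ x.ofLp) ⬝ᵥ (P₀ + ε • 1) *ᵥ (A *ᵥ x.ofLp) < x.ofLp ⬝ᵥ (P₀ + ε • 1) *ᵥ x.ofLp := by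
    intro x hx hC
    have hxx : x.ofLp ⬝ᵥ x.ofLp = 1 := by rw [← norm_sq_eq_dotProduct, hx, one_pow]
    have h1 := hfu _ ⟨_, vecMulVec_mem_kernelDensities hxx hC, rfl⟩
    have h2 : Φ (vecMulVec x.ofLp x.ofLp) =
        vecMulVec (A *ᵥ x.ofLp) (A *ᵥ x.ofLp) - vecMulVec x.ofLp x.ofLp := by
      simp [Φ, mul_vecMulVec, vecMulVec_mul, vecMul_transpose]
    rw [h2, map_sub] at h1
    have h3 : (A *ᵥ x.ofLp) ⬝ᵥ (A *ᵥ x.ofLp) ≤ ‖A‖ ^ 2 := by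
      have h4 := norm_act_le A x
      rw [hx, mul_one] at h4
      have h5 := norm_sq_eq_dotProduct (A.act x)
      rw [act] at h5 h4
      rw [← h5]
      gcongr
    rw [hquad, hquad, hxx]
    nlinarith
  refine ⟨P₀ + ε • 1, ?_, fun x hx hC => ?_⟩
  · refine PosDef.of_dotProduct_mulVec_pos ?_ fun x hx => ?_
    · simp [IsHermitian, conjTranspose_eq_transpose_of_trivial, hsymm]
    · rw [star_trivial, hquad]
      have := hnonneg _ (hpsd x)
      have : 0 < x ⬝ᵥ x := by simpa using dotProduct_star_self_pos_iff.2 hx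
      positivity
  · have hy : ‖WithLp.toLp 2 x‖ ≠ 0 := by simpa using hx
    have h1 := hunit (‖WithLp.toLp 2 x‖⁻¹ • WithLp.toLp 2 x)
      (by rw [norm_smul, norm_inv, norm_norm, inv_mul_cancel₀ hy])
      (by simp [mulVec_smul, hC])
    simp only [WithLp.ofLp_smul, mulVec_smul, smul_dotProduct, dotProduct_smul,
      smul_eq_mul] at h1
    have hpos : 0 < ‖WithLp.toLp 2 x‖⁻¹ := inv_pos.2 (lt_of_le_of_ne (norm_nonneg _) hy.symm)
    exact lt_of_mul_lt_mul_left (lt_of_mul_lt_mul_left h1 hpos.le) hpos.le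

/-! ### Output injection by orthogonal projection -/

/-- Injection step: a Euclidean contraction on `ker C` becomes a contraction on the whole
space after output injection. The gain replaces `A` by `A` composed with the orthogonal projection onto
`ker C`. -/
theorem exists_injection_contracting {A : Matrix (Fin n) (Fin n) ℝ}
    {C : Matrix (Fin l) (Fin n) ℝ}
    (h : ∀ x : EuclideanSpace ℝ (Fin n), x ≠ 0 → C.act x = 0 → ‖A.act x‖ < ‖x‖) :
    ∃ L : Matrix (Fin n) (Fin l) ℝ, ∀ x : EuclideanSpace ℝ (Fin n), x ≠ 0 →
      ‖(A + L * C).act x‖ < ‖x‖ := by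
  let K : Submodule ℝ (EuclideanSpace ℝ (Fin n)) := LinearMap.ker C.toEuclideanLin
  have hK : ∀ x, x ∈ K ↔ C.act x = 0 := fun x => LinearMap.mem_ker
  let T : Matrix (Fin n) (Fin n) ℝ := toEuclideanLin.symm K.starProjection.toLinearMap
  have hT : ∀ x, T.act x = K.starProjection x := fun x => by
    have : toEuclideanLin T = K.starProjection.toLinearMap := LinearEquiv.apply_symm_apply _ _
    exact LinearMap.congr_fun this x
  obtain ⟨L, hL⟩ := exists_eq_mul_of_ker_le (X := A * T - A) (Y := C) fun x hx => by
    have hx' : WithLp.toLp 2 x ∈ K := (hK _).2 (by simp [act, hx])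
    have h1 : (A * T - A).act (WithLp.toLp 2 x) = 0 := by
      rw [sub_act, mul_act, hT, Submodule.starProjection_eq_self_iff.2 hx', sub_self]
    exact congrArg WithLp.ofLp h1
  refine ⟨L, fun x hx => ?_⟩
  rw [← hL, add_sub_cancel, mul_act, hT]
  by_cases h0 : K.starProjection x = 0
  · rw [h0, act_zero, norm_zero]
    exact norm_pos_iff.2 hx
  · refine (h _ h0 ((hK _).1 (K.starProjection_apply_mem x))).trans_le ?_
    exact K.norm_starProjection_apply_le x

end Matrix

/-! ### Class `𝒦` and `𝒦ℒ` functions -/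

theorem isClassK_mul_left {c : ℝ≥0} (hc : 0 < c) : IsClassK fun r => c * r :=
  ⟨by fun_prop, fun _ _ h => mul_lt_mul_of_pos_left h hc, mul_zero c⟩

/-- The discount sequence `a` made strictly positive, as strict monotonicity of the gains
requires. -/
noncomputable def positiveDiscount (a : ℕ → ℝ≥0) (t : ℕ) : ℝ≥0 := a t + ((t : ℝ≥0) + 1)⁻¹

theorem le_positiveDiscount (a : ℕ → ℝ≥0) (t : ℕ) : a t ≤ positiveDiscount a t :=
  le_self_add

theorem IsClassL.isClassKL_positiveDiscount_mul {a : ℕ → ℝ≥0} (ha : IsClassL a) :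
    IsClassKL fun r t => positiveDiscount a t * r := by
  refine ⟨fun t => isClassK_mul_left (by unfold positiveDiscount; positivity), fun r => ⟨?_, ?_⟩⟩
  · intro s t hst
    have h : ((t : ℝ≥0) + 1)⁻¹ ≤ ((s : ℝ≥0) + 1)⁻¹ := by gcongr
    exact mul_le_mul_left (add_le_add (ha.1 hst) h) r
  · have h : Tendsto (fun t : ℕ => ((t : ℝ≥0) + 1)⁻¹) atTop (𝓝 0) := by
      have h1 := tendsto_one_div_add_atTop_nhds_zero_nat (𝕜 := ℝ≥0)
      simpa using h1
    simpa [positiveDiscount] using (ha.2.add h).mul_const r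

theorem IsClassL.pred {a : ℕ → ℝ≥0} (ha : IsClassL a) : IsClassL fun t => a (t - 1) :=
  ⟨fun _ _ h => ha.1 (Nat.sub_le_sub_right h 1), ha.2.comp (tendsto_sub_atTop_nat 1)⟩

theorem IsClassK.tendsto_zero {α : ℝ≥0 → ℝ≥0} (hα : IsClassK α) {r : ℕ → ℝ≥0}
    (h : Tendsto (fun t => α (r t)) atTop (𝓝 0)) : Tendsto r atTop (𝓝 0) := by
  refine tendsto_order.2 ⟨fun a ha => absurd ha not_lt_zero, fun a ha => ?_⟩
  have h1 : 0 < α a := hα.2.2 ▸ hα.2.1 ha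
  exact (h.eventually_lt_const h1).mono fun t ht => hα.2.1.lt_iff_lt.1 ht

namespace LinearSystem

variable {nx nu nw nv ny : ℕ} {S : LinearSystem nx nu nw nv ny}
  {P Q : Matrix (Fin nx) (Fin nx) ℝ} {L : Matrix (Fin nx) (Fin ny) ℝ}

/-! ### Existence of a Lyapunov triple -/

/-- Detectability says that the trajectories of `A` with zero output decay. -/
theorem Detectable.tendsto_pow_act (h : S.Detectable) (x : EuclideanSpace ℝ (Fin nx))
    (hx : ∀ t : ℕ, S.C.act ((S.A ^ t).act x) = 0) :
    Tendsto (fun t : ℕ => (S.A ^ t).act x) atTop (𝓝 0) := by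
  refine h _ fun t => ⟨?_, ?_⟩
  · simp [toSystem, act_zero, pow_succ', mul_act]
  · simp [toSystem, act_zero, hx]

/-- A detectable system has an output injection and a quadratic Lyapunov function for the resulting
error dynamics. In the coordinates `z = P^{1/2} x` the two steps of the construction become
statements about the Euclidean norm. -/
theorem Detectable.exists_isLyapunovTriple (h : S.Detectable) :
    ∃ (P Q : Matrix (Fin nx) (Fin nx) ℝ) (L : Matrix (Fin nx) (Fin ny) ℝ),
      S.IsLyapunovTriple P Q L := by
  obtain ⟨P, hP, hcontr⟩ := exists_posDef_contracting_on_ker h.tendsto_pow_act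
  set R := CFC.sqrt P with hR
  have hRR : R * R = P := hP.posSemidef.sqrt_mul_sqrt
  have hRu : IsUnit R := isUnit_of_mul_isUnit_left (hRR ▸ hP.isUnit)
  have hRdet := (isUnit_iff_isUnit_det R).1 hRu
  have hRinv : R⁻¹ * R = 1 := nonsing_inv_mul R hRdet
  have hRinv' : R * R⁻¹ = 1 := mul_nonsing_inv R hRdet
  have hRnorm : ∀ x, ‖R.act x‖ ^ 2 = x.ofLp ⬝ᵥ P *ᵥ x.ofLp := hP.posSemidef.norm_sqrt_act_sq
  obtain ⟨L, hL⟩ := exists_injection_contracting (A := R * S.A * R⁻¹) (C := S.C * R⁻¹)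
    fun z hz hCz => by
      have hz' : z = R.act (R⁻¹.act z) := by rw [← mul_act, hRinv', one_act]
      have hx : R⁻¹.act z ≠ 0 := fun h0 => hz (by rw [hz', h0, act_zero])
      rw [mul_act] at hCz
      have h1 := hcontr (R⁻¹.act z).ofLp (by simpa using hx) (congrArg WithLp.ofLp hCz)
      refine lt_of_pow_lt_pow_left₀ 2 (norm_nonneg _) ?_
      rw [mul_act, mul_act, hRnorm]
      conv_rhs => rw [hz', hRnorm]
      exact h1
  refine ⟨P, P - (S.AL (R⁻¹ * L))ᵀ * P * S.AL (R⁻¹ * L), R⁻¹ * L, hP, ?_, by abel⟩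
  refine PosDef.of_dotProduct_mulVec_pos ?_ fun x hx => ?_
  · have hPt : Pᵀ = P := by
      simpa [IsHermitian, conjTranspose_eq_transpose_of_trivial] using hP.isHermitian
    simp [IsHermitian, conjTranspose_eq_transpose_of_trivial, hPt, Matrix.mul_assoc]
  · have hconj : R * S.AL (R⁻¹ * L) = (R * S.A * R⁻¹ + L * (S.C * R⁻¹)) * R := by
      rw [AL, Matrix.mul_add, Matrix.add_mul, Matrix.mul_assoc (R * S.A), hRinv, Matrix.mul_one,
        ← Matrix.mul_assoc, ← Matrix.mul_assoc, hRinv', Matrix.one_mul, Matrix.mul_assoc L,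
        Matrix.mul_assoc S.C, hRinv, Matrix.mul_one]
    have hRx : R.act (WithLp.toLp 2 x) ≠ 0 := fun h0 => hx <| by
      have h1 : R⁻¹.act (R.act (WithLp.toLp 2 x)) = 0 := by rw [h0, act_zero]
      rw [← mul_act, hRinv, one_act] at h1
      simpa using h1
    have h1 := hL _ hRx
    rw [← mul_act, ← hconj] at h1
    have h2 : ‖(R * S.AL (R⁻¹ * L)).act (WithLp.toLp 2 x)‖ ^ 2 <
        ‖R.act (WithLp.toLp 2 x)‖ ^ 2 := by gcongr
    have hRt : Rᵀ = R := transpose_sqrt P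
    rw [norm_act_sq, hRnorm, transpose_mul, hRt, Matrix.mul_assoc, ← Matrix.mul_assoc R, hRR,
      ← Matrix.mul_assoc] at h2
    rw [star_trivial, sub_mulVec, dotProduct_sub]
    linarith

/-! ### Detectability and incremental stability -/

theorem IsLyapunovTriple.isClassL (h : S.IsLyapunovTriple P Q L) {m : ℕ}
    (M : Matrix (Fin nx) (Fin m) ℝ) :
    IsClassL fun t => (gainP P (S.AL L ^ t * M)).toNNReal := by
  refine ⟨fun s t hst => Real.toNNReal_le_toNNReal (h.antitone_gainP M hst), ?_⟩
  simpa [Function.comp_def] using (continuous_real_toNNReal.tendsto 0).comp (h.tendsto_gainP M)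

/-- The bound of `IsLyapunovTriple.dist_le` with all gains relaxed to class `𝒦ℒ` functions. -/
theorem IsLyapunovTriple.isSumIIOSS (h : S.IsLyapunovTriple P Q L) : S.toSystem.IsSumIIOSS := by
  -- For `nx = 0` the eigenvalue `λ_min(P)` is `0`, but then all state distances vanish and any
  -- positive slope will do.
  obtain ⟨c, hc, hcP⟩ : ∃ c : ℝ≥0, 0 < c ∧ ∀ x χ : EuclideanSpace ℝ (Fin nx),
      (c : ℝ) * dist x χ ≤ √(lambdaMin P) * dist x χ := by
    rcases Nat.eq_zero_or_pos nx with rfl | hn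
    · refine ⟨1, one_pos, fun x χ => ?_⟩
      rw [Subsingleton.elim x χ]
      simp
    · exact ⟨⟨√(lambdaMin P), Real.sqrt_nonneg _⟩, Real.sqrt_pos.2 (lambdaMin_pos hn.ne' h.1),
        fun x χ => le_rfl⟩
  refine ⟨fun r => c * r, _, _, _, _, _, isClassK_mul_left hc,
    (h.isClassL (1 : Matrix (Fin nx) (Fin nx) ℝ)).isClassKL_positiveDiscount_mul,
    (h.isClassL S.E).pred.isClassKL_positiveDiscount_mul,
    (h.isClassL (L * S.F)).pred.isClassKL_positiveDiscount_mul,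
    (h.isClassL (S.B + L * S.D)).pred.isClassKL_positiveDiscount_mul,
    (h.isClassL L).pred.isClassKL_positiveDiscount_mul, ?_⟩
  intro x χ u υ w ω v ν y ζ hx hχ t
  have key : ∀ {m : ℕ} (M : Matrix (Fin nx) (Fin m) ℝ) (a : ℕ → ℝ≥0) (k t : ℕ)
      (p q : EuclideanSpace ℝ (Fin m)), a t = (gainP P (S.AL L ^ k * M)).toNNReal →
      gainP P (S.AL L ^ k * M) * dist p q ≤ (positiveDiscount a t : ℝ) * dist p q := by
    intro m M a k t p q ha
    refine mul_le_mul_of_nonneg_right ?_ dist_nonneg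
    refine le_trans ?_ (NNReal.coe_le_coe.2 (le_positiveDiscount a t))
    rw [ha]
    exact Real.le_coe_toNNReal _
  rw [← NNReal.coe_le_coe]
  push_cast
  refine ((hcP _ _).trans (h.dist_le hx hχ t)).trans ?_
  refine add_le_add ?_
    (Finset.sum_le_sum fun τ _ => add_le_add (add_le_add (add_le_add ?_ ?_) ?_) ?_)
  · rw [← Matrix.mul_one (S.AL L ^ t)]
    exact key 1 _ t t _ _ rfl
  all_goals exact key _ _ _ _ _ _ rfl

/-- A trajectory with zero output is compared with the zero solution. -/
theorem detectable_of_isSumIIOSS (h : S.toSystem.IsSumIIOSS) : S.Detectable := by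
  obtain ⟨α, β, γ, δ, ε, φ, hα, hβ, hγ, hδ, hε, hφ, hbound⟩ := h
  intro x hx
  have h0 : S.toSystem.IsSolution 0 0 0 0 0 := fun t => by simp [toSystem, act_zero]
  have hle : ∀ t, α (nndist (x t) 0) ≤ β (nndist (x 0) 0) t := fun t => by
    have h1 := hbound x 0 0 0 0 0 0 0 0 0 hx h0 t
    simpa [(hγ.1 _).2.2, (hδ.1 _).2.2, (hε.1 _).2.2, (hφ.1 _).2.2] using h1
  have h1 : Tendsto (fun t => nndist (x t) 0) atTop (𝓝 0) :=
    hα.tendsto_zero (tendsto_of_tendsto_of_tendsto_of_le_of_le tendsto_const_nhds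
      (hβ.2 (nndist (x 0) 0)).2 (fun _ => zero_le) hle)
  rw [tendsto_iff_dist_tendsto_zero]
  simpa [Function.comp_def] using (NNReal.continuous_coe.tendsto 0).comp h1

end LinearSystem

theorem mainTheorem2 (nx nu nw nv ny : ℕ) (S : LinearSystem nx nu nw nv ny) :
    (S.Detectable ↔ S.toSystem.IsSumIIOSS) ∧
    (S.Detectable → ∃ (P Q : Matrix (Fin nx) (Fin nx) ℝ) (L : Matrix (Fin nx) (Fin ny) ℝ),
      S.IsLyapunovTriple P Q L) ∧
    (∀ (L : Matrix (Fin nx) (Fin ny) ℝ)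
      (x χ : ℕ → EuclideanSpace ℝ (Fin nx)) (u υ : ℕ → EuclideanSpace ℝ (Fin nu))
      (w ω : ℕ → EuclideanSpace ℝ (Fin nw)) (v ν : ℕ → EuclideanSpace ℝ (Fin nv))
      (y ζ : ℕ → EuclideanSpace ℝ (Fin ny)),
      S.toSystem.IsSolution x u w v y → S.toSystem.IsSolution χ υ ω ν ζ →
      ∀ t : ℕ, x t - χ t = (S.AL L ^ t).act (x 0 - χ 0) +
        ∑ τ ∈ Finset.Icc 1 t, (S.AL L ^ (τ - 1)).act
          (S.E.act (w (t - τ) - ω (t - τ)) + (L * S.F).act (v (t - τ) - ν (t - τ)) +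
            (S.B + L * S.D).act (u (t - τ) - υ (t - τ)) - L.act (y (t - τ) - ζ (t - τ)))) ∧
    (∀ (P Q : Matrix (Fin nx) (Fin nx) ℝ) (L : Matrix (Fin nx) (Fin ny) ℝ),
      S.IsLyapunovTriple P Q L →
      (∀ (m : ℕ) (M : Matrix (Fin nx) (Fin m) ℝ),
        Antitone (fun t : ℕ => gainP P (S.AL L ^ t * M)) ∧
        Tendsto (fun t : ℕ => gainP P (S.AL L ^ t * M)) atTop (𝓝 0)) ∧
      ∀ (x χ : ℕ → EuclideanSpace ℝ (Fin nx)) (u υ : ℕ → EuclideanSpace ℝ (Fin nu))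
        (w ω : ℕ → EuclideanSpace ℝ (Fin nw)) (v ν : ℕ → EuclideanSpace ℝ (Fin nv))
        (y ζ : ℕ → EuclideanSpace ℝ (Fin ny)),
        S.toSystem.IsSolution x u w v y → S.toSystem.IsSolution χ υ ω ν ζ →
        ∀ t : ℕ, √(lambdaMin P) * dist (x t) (χ t) ≤
          gainP P (S.AL L ^ t) * dist (x 0) (χ 0) +
          ∑ τ ∈ Finset.Icc 1 t,
            (gainP P (S.AL L ^ (τ - 1) * S.E) * dist (w (t - τ)) (ω (t - τ)) +
              gainP P (S.AL L ^ (τ - 1) * (L * S.F)) * dist (v (t - τ)) (ν (t - τ)) +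
              gainP P (S.AL L ^ (τ - 1) * (S.B + L * S.D)) * dist (u (t - τ)) (υ (t - τ)) +
              gainP P (S.AL L ^ (τ - 1) * L) * dist (y (t - τ)) (ζ (t - τ)))) := by
  exact ⟨⟨fun h => let ⟨_, _, _, hP⟩ := h.exists_isLyapunovTriple; hP.isSumIIOSS,
      S.detectable_of_isSumIIOSS⟩,
    fun h => h.exists_isLyapunovTriple,
    fun L _ _ _ _ _ _ _ _ _ _ h h' => S.error_formula L h h',
    fun _ _ _ hP => ⟨fun _ M => ⟨hP.antitone_gainP M, hP.tendsto_gainP M⟩,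
      fun _ _ _ _ _ _ _ _ _ _ h h' => hP.dist_le h h'⟩⟩
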